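/- There is an absolute constant $C>0$ such that the following holds for all $\varepsilon\in(0,1/4]$, $\delta\in(0,1)$ and all integers $n\ge 1$ and $d,k\ge 0$ with $k\le d$ and $k\ge C\,\varepsilon^{-2}\log(n/\delta)$. Let $y_1,\dots,y_n$ be points of the unit sphere $\mathbb S^d\subset\mathbb R^{d+1}$, and let $H$ be a uniformly random $(k+1)$-dimensional linear subspace of $\mathbb R^{d+1}$ (that is, distributed according to the rotation-invariant probability measure on the Grassmannian). Let $\pi_H(y)\in H$ denote the orthogonal projection of $y$ onto $H$, scaled by $(d+1)/(k+1)$. Then, with probability at least $1-\delta$, all $\pi_H(y_i)$ are non-zero, and the renormalized points $x_i=\pi_H(y_i)/\|\pi_H(y_i)\|$ on the unit sphere $\mathbb S^k$ of $H$ have $\varepsilon$-distortion from the points $y_i$ with respect to geodesic distance: there is a constant $c>0$ such that for all $i,j$ $$(1-\varepsilon)\,\angle(y_i,y_j)\;\le\; c\,\angle(x_i,x_j)\;\le\;(1+\varepsilon)\,\angle(y_i,y_j),$$ where $\angle(u,v)$, the angle between the unit vectors $u$ and $v$, is their geodesic distance on the sphere. -/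

import Mathlib

open MeasureTheory

noncomputable section

namespace SphericalJL

/-- Euclidean space of dimension `N`. -/
abbrev E (N : ℕ) : Type := EuclideanSpace ℝ (Fin N)

/-- The orthogonal group of `ℝ^N`, with the operator-norm topology and its Borel sets. -/
abbrev O (N : ℕ) : Type := unitary (E N →L[ℝ] E N)

instance instContinuousStarOperators (N : ℕ) : ContinuousStar (E N →L[ℝ] E N) :=
  ⟨(ContinuousLinearMap.adjoint (𝕜 := ℝ) (E := E N) (F := E N)).continuous⟩

instance instCompactSpaceO (N : ℕ) : CompactSpace (O N) := by
  suffices h : IsCompact (unitary (E N →L[ℝ] E N) : Set (E N →L[ℝ] E N)) from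
    isCompact_iff_compactSpace.mp h
  have : FiniteDimensional ℝ (E N →L[ℝ] E N) := inferInstance
  have : ProperSpace (E N →L[ℝ] E N) := FiniteDimensional.proper ℝ _
  refine Metric.isCompact_of_isClosed_isBounded isClosed_unitary ?_
  refine (Metric.isBounded_closedBall (x := (0 : E N →L[ℝ] E N)) (r := 1)).subset ?_
  intro U hU
  rw [mem_closedBall_zero_iff]
  refine ContinuousLinearMap.opNorm_le_bound _ zero_le_one fun x => ?_
  have h := (Unitary.linearIsometryEquiv (⟨U, hU⟩ : O N)).norm_map x
  rw [one_mul]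
  exact h.le

/-- The Grassmannian of `m`-dimensional linear subspaces of `ℝ^N`. -/
def Gr (N m : ℕ) : Type := {H : Submodule ℝ (E N) // Module.finrank ℝ H = m}

/-- The orthogonal projection of `ℝ^N` onto `H`, as an operator on `ℝ^N`. -/
def Gr.proj {N m : ℕ} (H : Gr N m) : E N →L[ℝ] E N := H.1.starProjection

/-- The Borel sets of the Grassmannian, whose topology is the one it inherits from the operators
on `ℝ^N` when a subspace is identified with the orthogonal projection onto it. -/
instance instMeasurableSpaceGr (N m : ℕ) : MeasurableSpace (Gr N m) :=
  MeasurableSpace.comap Gr.proj inferInstance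

/-- The image of the subspace `H` under the orthogonal map `U`. -/
def Gr.rotate {N m : ℕ} (U : O N) (H : Gr N m) : Gr N m :=
  ⟨H.1.map ((Unitary.linearIsometryEquiv U).toLinearEquiv : E N →ₗ[ℝ] E N),
    (LinearEquiv.finrank_map_eq _ _).trans H.2⟩

/-- The subspace of `ℝ^N` spanned by the first `m` standard basis vectors. -/
def Gr.std {N m : ℕ} (h : m ≤ N) : Gr N m :=
  ⟨Submodule.span ℝ (Set.range fun i : Fin m => EuclideanSpace.basisFun (Fin N) ℝ (Fin.castLE h i)),
    by
      have hl := (EuclideanSpace.basisFun (Fin N) ℝ).orthonormal.linearIndependent.comp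
        (Fin.castLE h) (Fin.castLE_injective h)
      exact (finrank_span_eq_card hl).trans (Fintype.card_fin m)⟩

/-- The uniform distribution on the `m`-dimensional subspaces of `ℝ^N`: the law of `U(H₀)`, where
`U` is distributed according to the Haar probability measure of the orthogonal group and `H₀` is a
fixed `m`-dimensional subspace. -/
def uniformGr {N m : ℕ} (h : m ≤ N) : Measure (Gr N m) :=
  (Measure.haarMeasure (⊤ : TopologicalSpace.PositiveCompacts (O N))).map
    fun U => Gr.rotate U (Gr.std h)

theorem proj_rotate {N m : ℕ} (U : O N) (H : Gr N m) :
    (Gr.rotate U H).proj =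
      (U : E N →L[ℝ] E N) * H.proj * ((star U : O N) : E N →L[ℝ] E N) := by
  ext1 x
  exact Submodule.starProjection_map_apply (Unitary.linearIsometryEquiv U) H.1 x

theorem measurable_rotate {N m : ℕ} (H : Gr N m) : Measurable fun U : O N => Gr.rotate U H := by
  refine measurable_comap_iff.mpr ?_
  have : (Gr.proj ∘ fun U : O N => Gr.rotate U H) = fun U : O N =>
      (U : E N →L[ℝ] E N) * H.proj * ((star U : O N) : E N →L[ℝ] E N) :=
    funext fun U => proj_rotate U H
  rw [this]
  refine Continuous.measurable ?_
  fun_prop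

instance instIsProbabilityMeasureUniformGr {N m : ℕ} (h : m ≤ N) :
    IsProbabilityMeasure (uniformGr h) := by
  have : IsProbabilityMeasure
      (Measure.haarMeasure (⊤ : TopologicalSpace.PositiveCompacts (O N))) :=
    ⟨by simpa using Measure.haarMeasure_self (K₀ := (⊤ : TopologicalSpace.PositiveCompacts (O N)))⟩
  exact Measure.isProbabilityMeasure_map (measurable_rotate _).aemeasurable

/-- The orthogonal projection of `y ∈ ℝ^N` onto the `m`-dimensional subspace `H`, scaled by
`N / m`, as a point of the Euclidean space `H`. -/
def scaledProj {N m : ℕ} (H : Gr N m) (y : E N) : H.1 :=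
  ((N : ℝ) / (m : ℝ)) • H.1.orthogonalProjectionOnto y

/-- The radial projection `x ↦ x / ‖x‖` to the unit sphere (meaningful for `x ≠ 0`). -/
def toUnit {V : Type*} [NormedAddCommGroup V] [NormedSpace ℝ V] (x : V) : V := ‖x‖⁻¹ • x

/-- The geodesic distance on the unit sphere: the length of the shorter great-circle arc between
the unit vectors `x` and `y`, which is the angle between them. -/
def geodesicDist {V : Type*} [NormedAddCommGroup V] [InnerProductSpace ℝ V] (x y : V) : ℝ :=
  InnerProductGeometry.angle x y

/-- `γ`-distortion of the distances `g` on the new points from the distances `f` on the original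
ones, up to one common scaling constant `c`. -/
def HasDistortion {ι : Type*} (γ : ℝ) (f g : ι → ι → ℝ) : Prop :=
  ∃ c : ℝ, 0 < c ∧ ∀ i j, (1 - γ) * f i j ≤ c * g i j ∧ c * g i j ≤ (1 + γ) * f i j

/-- All points `y i` have non-zero projections to `H`, so that they can be renormalized, and the
renormalized projections, as points of the unit sphere of `H`, have `γ`-distortion from the points
`y i` with respect to geodesic distances. -/
def ProjectsWithDistortion {ι : Type*} {N m : ℕ} (γ : ℝ) (y : ι → Metric.sphere (0 : E N) 1)
    (H : Gr N m) : Prop :=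
  (∀ i, scaledProj H (y i : E N) ≠ 0) ∧
    HasDistortion γ (fun i j => geodesicDist (y i : E N) (y j : E N))
      (fun i j => geodesicDist (toUnit (scaledProj H (y i : E N)))
        (toUnit (scaledProj H (y j : E N))))

end SphericalJL

end

namespace SphericalJL

/-! Angles between projected points are controlled through norms of finitely many fixed vectors. For
unit vectors `u ≠ ±v`, normalize `u + v` and `u - v` to orthonormal `p`, `q`; then `u = c p + s q`,
`v = c p - s q`, and the half angle has tangent `s / c`. If a linear map `L` preserves the squared
norms of `p`, `q` and `(p + q) / √2` up to `ε / 8`, the Gram matrix of `L p`, `L q` is nearly the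
identity. The tangent of the half angle then changes by a factor at most `1 + ε`
(`half_tan_bounds`), and so does the angle, by concavity of `arctan`. The error is relative, however
close the angle is to `0` or `π`.

Here `L` is the projection scaled by `√(N / m)`. By rotation invariance, `‖H.proj y‖ ^ 2` for a
fixed unit `y` is distributed as `‖P x‖ ^ 2 / ‖x‖ ^ 2`, with `x` Gaussian and `P` a fixed coordinate
projection (`uniformGr_norm_proj_sq_mem`). Comparison with an anisotropic Gaussian bounds both tails
by `exp (-m η ^ 2 / 18)`, and a union bound over three vectors per pair concludes. -/

/-! ### Half-angle geometry under nearly isometric linear maps. -/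

/-- Concavity of `arctan` on the half-line; it turns ratios of half-angle tangents into ratios of
angles. -/
theorem arctan_mul_le {k x : ℝ} (hk : 1 ≤ k) (hx : 0 ≤ x) :
    Real.arctan (k * x) ≤ k * Real.arctan x := by
  have hd : ∀ t : ℝ, HasDerivAt (fun t => k * Real.arctan t - Real.arctan (k * t))
      (k * (1 / (1 + t ^ 2)) - 1 / (1 + (k * t) ^ 2) * (k * 1)) t := fun t =>
    ((Real.hasDerivAt_arctan t).const_mul k).sub
      (((hasDerivAt_id t).const_mul k).arctan)
  have hmono : MonotoneOn (fun t => k * Real.arctan t - Real.arctan (k * t)) (Set.Ici 0) := by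
    refine monotoneOn_of_deriv_nonneg (convex_Ici 0)
      (fun t _ => (hd t).continuousAt.continuousWithinAt)
      (fun t _ => (hd t).differentiableAt.differentiableWithinAt) fun t _ => ?_
    rw [(hd t).deriv]
    have h1 : 1 / (1 + (k * t) ^ 2) ≤ 1 / (1 + t ^ 2) := by
      apply one_div_le_one_div_of_le (by positivity)
      rw [mul_pow]
      nlinarith [sq_nonneg t, mul_le_mul_of_nonneg_right (one_le_pow₀ hk : 1 ≤ k ^ 2) (sq_nonneg t)]
    nlinarith
  have := hmono (Set.mem_Ici.2 le_rfl) (Set.mem_Ici.2 hx) hx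
  simp only [Real.arctan_zero, mul_zero, sub_zero] at this
  linarith

/-- With `R = ‖a‖ * ‖b‖`, `D` is `R sin θ`, and the formula is `tan (θ / 2) = sin θ / (1 + cos θ)`.
Positivity of `D` excludes the angles `0` and `π`. -/
theorem angle_eq_two_mul_arctan {V : Type*} [NormedAddCommGroup V] [InnerProductSpace ℝ V]
    {a b : V} {D : ℝ} (hD : 0 < D)
    (h : (inner ℝ a b) ^ 2 + D ^ 2 = (‖a‖ * ‖b‖) ^ 2) :
    InnerProductGeometry.angle a b = 2 * Real.arctan (D / (‖a‖ * ‖b‖ + inner ℝ a b)) := by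
  set θ := InnerProductGeometry.angle a b with hθ
  set R := ‖a‖ * ‖b‖ with hR
  set g : ℝ := inner ℝ a b with hg
  have hR0 : 0 ≤ R := by positivity
  have hcos : Real.cos θ * R = g := InnerProductGeometry.cos_angle_mul_norm_mul_norm a b
  have hsin0 : 0 ≤ Real.sin θ := InnerProductGeometry.sin_angle_nonneg a b
  have hsin : Real.sin θ * R = D := by
    have h1 := Real.sin_sq_add_cos_sq θ
    have h2 : (Real.sin θ * R) ^ 2 = D ^ 2 := by
      rw [← hcos] at h
      linear_combination R ^ 2 * h1 - h
    exact (pow_left_inj₀ (by positivity) hD.le two_ne_zero).1 h2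
  have hRpos : 0 < R := by
    rcases hR0.eq_or_lt with h0 | h0
    · rw [← h0] at hsin; linarith
    · exact h0
  have hsinpos : 0 < Real.sin θ := by
    by_contra hc
    have : Real.sin θ = 0 := le_antisymm (not_lt.1 hc) hsin0
    rw [this] at hsin; linarith
  have hθ0 : 0 ≤ θ := InnerProductGeometry.angle_nonneg a b
  have hθπ : θ < Real.pi := by
    refine lt_of_le_of_ne (InnerProductGeometry.angle_le_pi a b) fun hc => ?_
    rw [hc, Real.sin_pi] at hsinpos; exact lt_irrefl _ hsinpos
  have hc2 : 0 < Real.cos (θ / 2) :=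
    Real.cos_pos_of_mem_Ioo ⟨by linarith [Real.pi_pos], by linarith⟩
  have hs : Real.sin θ = 2 * Real.sin (θ / 2) * Real.cos (θ / 2) := by
    rw [← Real.sin_two_mul]; ring_nf
  have hc : Real.cos θ = 2 * Real.cos (θ / 2) ^ 2 - 1 := by
    rw [← Real.cos_two_mul]; ring_nf
  have key : D / (R + g) = Real.tan (θ / 2) := by
    rw [← hsin, ← hcos, hs, hc, Real.tan_eq_sin_div_cos]
    field_simp
    ring
  rw [key, Real.arctan_tan (by linarith) (by linarith)]
  ring

/-- `A`, `B` are the squared norms of the images of `p`, `q`, and `Δ` is the square root of their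
Gram determinant. After clearing denominators and isolating `R`, squaring eliminates it, leaving
inequalities linear in `g`. -/
theorem half_tan_bounds {A B Δ κ c s R g : ℝ} (hc : 0 < c) (hs : 0 < s) (hΔ : 0 < Δ)
    (hκ : 1 ≤ κ) (hA : A ≤ κ * Δ) (hA' : Δ ≤ κ * A) (hB : B ≤ κ * Δ) (hB' : Δ ≤ κ * B)
    (hg : g = c ^ 2 * A - s ^ 2 * B) (hR : 0 ≤ R)
    (h : g ^ 2 + (2 * c * s * Δ) ^ 2 = R ^ 2) :
    2 * c * s * Δ / (R + g) ≤ κ * (s / c) ∧ s / c ≤ κ * (2 * c * s * Δ / (R + g)) := by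
  have hκ0 : 0 < κ := by linarith
  have hD : 0 < 2 * c * s * Δ := by positivity
  have hRg : 0 < R + g := by
    have : |g| < R := abs_lt_of_sq_lt_sq (by nlinarith [pow_pos hD 2]) hR
    linarith [(abs_lt.1 this).1]
  constructor
  · have h1 : 2 * c ^ 2 * Δ - κ * g ≤ κ * R := by
      refine le_of_abs_le (abs_le_of_sq_le_sq ?_ (by positivity))
      have h2 : c ^ 2 * Δ - κ ^ 2 * s ^ 2 * Δ ≤ κ * g := by
        rw [hg]
        nlinarith [mul_le_mul_of_nonneg_left hA' (sq_nonneg c),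
          mul_le_mul_of_nonneg_left hB (mul_nonneg hκ0.le (sq_nonneg s))]
      have h3 : (κ * R) ^ 2 = κ ^ 2 * (g ^ 2 + (2 * c * s * Δ) ^ 2) := by rw [h]; ring
      rw [h3]
      nlinarith [mul_le_mul_of_nonneg_left h2 (by positivity : 0 ≤ 4 * c ^ 2 * Δ)]
    rw [mul_div_assoc', div_le_div_iff₀ hRg hc]
    nlinarith
  · have h2 : g ≤ κ * c ^ 2 * Δ - s ^ 2 * B := by
      rw [hg]; nlinarith [mul_le_mul_of_nonneg_left hA (sq_nonneg c)]
    have h4 : s ^ 2 * Δ ≤ κ * (s ^ 2 * B) := by nlinarith [mul_le_mul_of_nonneg_left hB' (sq_nonneg s)]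
    have h5 : 0 ≤ s ^ 2 * B := by
      have : 0 < s ^ 2 * Δ := by positivity
      nlinarith
    have h6 : 0 < κ * c ^ 2 * Δ := by positivity
    have h1 : R ≤ 2 * κ * c ^ 2 * Δ - g := by
      refine le_of_abs_le (abs_le_of_sq_le_sq ?_ (by linarith))
      rw [← h]
      have h7 : s ^ 2 * Δ ≤ κ ^ 2 * c ^ 2 * Δ - κ * g := by nlinarith
      nlinarith [mul_le_mul_of_nonneg_left h7 (by positivity : 0 ≤ 4 * c ^ 2 * Δ)]
    rw [mul_div_assoc', div_le_div_iff₀ hc hRg]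
    nlinarith

theorem inner_smul_add_smul_sub {X : Type*} [NormedAddCommGroup X] [InnerProductSpace ℝ X]
    (c s : ℝ) (x y : X) :
    inner ℝ (c • x + s • y) (c • x - s • y) = c ^ 2 * ‖x‖ ^ 2 - s ^ 2 * ‖y‖ ^ 2 := by
  simp only [inner_add_left, inner_sub_right, real_inner_smul_left, real_inner_smul_right,
    real_inner_self_eq_norm_sq, real_inner_comm x y, norm_smul, mul_pow, Real.norm_eq_abs, sq_abs]
  ring

theorem norm_smul_add_mul_norm_smul_sub_sq {X : Type*} [NormedAddCommGroup X]
    [InnerProductSpace ℝ X] (c s : ℝ) (x y : X) :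
    (‖c • x + s • y‖ * ‖c • x - s • y‖) ^ 2 =
      (c ^ 2 * ‖x‖ ^ 2 + s ^ 2 * ‖y‖ ^ 2) ^ 2 - (2 * c * s * inner ℝ x y) ^ 2 := by
  rw [mul_pow, norm_add_sq_real, norm_sub_sq_real]
  simp only [real_inner_smul_left, real_inner_smul_right, norm_smul, mul_pow, Real.norm_eq_abs,
    sq_abs]
  ring

/-- The third hypothesis is the polarization identity in disguise: it forces `|M| ≤ 2 * η`, so the
Gram determinant is close to `1`. -/
theorem sqrt_gram_bounds {A B M η : ℝ} (hη : 0 < η) (hη' : η ≤ 1 / 32) (hA : |A - 1| ≤ η)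
    (hB : |B - 1| ≤ η) (hM : |(A + B + 2 * M) / 2 - 1| ≤ η) :
    1 - 3 * η ≤ √(A * B - M ^ 2) ∧ √(A * B - M ^ 2) ≤ 1 + η ∧ 0 ≤ A * B - M ^ 2 := by
  rw [abs_le] at hA hB hM
  have hM2 : M ^ 2 ≤ (2 * η) ^ 2 := sq_le_sq' (by linarith) (by linarith)
  have hAB : (1 - η) * (1 - η) ≤ A * B :=
    mul_le_mul (by linarith) (by linarith) (by linarith) (by linarith)
  have hAB' : A * B ≤ (1 + η) * (1 + η) :=
    mul_le_mul (by linarith) (by linarith) (by linarith) (by linarith)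
  have h : (1 - 3 * η) ^ 2 ≤ A * B - M ^ 2 := by nlinarith
  exact ⟨Real.le_sqrt_of_sq_le h,
    Real.sqrt_le_iff.2 ⟨by linarith, by linarith [sq_nonneg M, sq (1 + η)]⟩,
    (sq_nonneg _).trans h⟩

theorem angle_map_bounds {V W : Type*} [NormedAddCommGroup V] [InnerProductSpace ℝ V]
    [NormedAddCommGroup W] [InnerProductSpace ℝ W] (L : V →ₗ[ℝ] W) {p q : V} {c s ε : ℝ}
    (hp : ‖p‖ = 1) (hq : ‖q‖ = 1) (hpq : inner ℝ p q = 0) (hc : 0 < c) (hs : 0 < s)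
    (hcs : c ^ 2 + s ^ 2 = 1) (hε : 0 < ε) (hε' : ε ≤ 1 / 4)
    (h1 : |‖L p‖ ^ 2 - 1| ≤ ε / 8) (h2 : |‖L q‖ ^ 2 - 1| ≤ ε / 8)
    (h3 : |‖L (p + q)‖ ^ 2 / 2 - 1| ≤ ε / 8) :
    (1 - ε) * InnerProductGeometry.angle (c • p + s • q) (c • p - s • q) ≤
        InnerProductGeometry.angle (L (c • p + s • q)) (L (c • p - s • q)) ∧
      InnerProductGeometry.angle (L (c • p + s • q)) (L (c • p - s • q)) ≤
        (1 + ε) * InnerProductGeometry.angle (c • p + s • q) (c • p - s • q) := by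
  have hD : 0 < 2 * c * s := by positivity
  have hang : InnerProductGeometry.angle (c • p + s • q) (c • p - s • q) =
      2 * Real.arctan (s / c) := by
    have hn : ‖c • p + s • q‖ * ‖c • p - s • q‖ = 1 := by
      have := norm_smul_add_mul_norm_smul_sub_sq c s p q
      rw [hp, hq, hpq] at this
      refine (pow_left_inj₀ (by positivity) zero_le_one two_ne_zero).1 ?_
      rw [this]
      linear_combination (c ^ 2 + s ^ 2 + 1) * hcs
    have hi := inner_smul_add_smul_sub c s p q
    rw [hp, hq] at hi
    rw [angle_eq_two_mul_arctan hD, hn, hi]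
    · congr 2
      rw [div_eq_div_iff (by nlinarith [sq_nonneg s, pow_pos hc 2]) hc.ne']
      linear_combination s * hcs
    · rw [hn, hi]
      linear_combination (c ^ 2 + s ^ 2 + 1) * hcs
  set A := ‖L p‖ ^ 2 with hA
  set B := ‖L q‖ ^ 2 with hB
  set M : ℝ := inner ℝ (L p) (L q) with hM
  have hsum : ‖L (p + q)‖ ^ 2 = A + B + 2 * M := by
    rw [map_add, norm_add_sq_real]; ring
  rw [hsum] at h3
  have hη0 : 0 < ε / 8 := by positivity
  obtain ⟨hΔlow, hΔup, hΔnn⟩ := sqrt_gram_bounds hη0 (by linarith) h1 h2 h3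
  have hΔsq : √(A * B - M ^ 2) ^ 2 = A * B - M ^ 2 := Real.sq_sqrt hΔnn
  rw [abs_le] at h1 h2
  have hi := inner_smul_add_smul_sub c s (L p) (L q)
  have hn := norm_smul_add_mul_norm_smul_sub_sq c s (L p) (L q)
  rw [← hA, ← hB] at hi hn
  rw [← hM] at hn
  clear h3
  clear_value A B M
  set Δ := √(A * B - M ^ 2) with hΔ
  have hΔ0 : 0 < Δ := by linarith
  have hb1 : 1 + ε / 8 ≤ (1 + ε) * Δ := by nlinarith
  have hb2 : 1 + ε / 8 ≤ (1 + ε) * (1 - ε / 8) := by nlinarith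
  have hlow : ∀ X : ℝ, -(ε / 8) ≤ X - 1 → Δ ≤ (1 + ε) * X := fun X hX =>
    hΔup.trans (hb2.trans (mul_le_mul_of_nonneg_left (by linarith) (by linarith)))
  have hrel : (inner ℝ (c • L p + s • L q) (c • L p - s • L q)) ^ 2 + (2 * c * s * Δ) ^ 2 =
      (‖c • L p + s • L q‖ * ‖c • L p - s • L q‖) ^ 2 := by
    rw [hi, hn, mul_pow (2 * c * s) Δ, hΔsq]
    ring
  have hangL := angle_eq_two_mul_arctan (mul_pos hD hΔ0) hrel
  obtain ⟨hu, hl⟩ := half_tan_bounds (κ := 1 + ε) hc hs hΔ0 (by linarith) (by linarith)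
    (hlow A (by linarith)) (by linarith) (hlow B (by linarith)) hi (by positivity) hrel
  rw [hang, map_add, map_sub, map_smul, map_smul, hangL]
  set T := 2 * c * s * Δ /
    (‖c • L p + s • L q‖ * ‖c • L p - s • L q‖ + inner ℝ (c • L p + s • L q) (c • L p - s • L q))
  have ht : 0 < s / c := by positivity
  have hT : 0 ≤ T := by
    have := ht.trans_le hl
    exact (pos_of_mul_pos_right this (by linarith)).le
  have e1 := (Real.arctan_mono hu).trans (arctan_mul_le (by linarith) ht.le)
  have e2 := (Real.arctan_mono hl).trans (arctan_mul_le (by linarith) hT)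
  have hT' : 0 ≤ Real.arctan T := Real.arctan_nonneg.2 hT
  constructor
  -- The lower bound has the factor `1 / (1 + ε)`, which is at least `1 - ε`.
  · have : (1 - ε) * Real.arctan (s / c) ≤ (1 - ε) * ((1 + ε) * Real.arctan T) :=
      mul_le_mul_of_nonneg_left e2 (by linarith)
    have h0 : (1 - ε) * ((1 + ε) * Real.arctan T) = Real.arctan T - ε ^ 2 * Real.arctan T := by ring
    have h00 := mul_nonneg (sq_nonneg ε) hT'
    linarith
  · linarith

/-- The test vectors `p`, `q`, `(p + q) / √2` are chosen before `L`, so that a union bound can be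
applied to them when `L` is random. -/
theorem angle_map_bounds_of_norm_eq_one {V : Type*} [NormedAddCommGroup V]
    [InnerProductSpace ℝ V] {u v : V}
    (hu : ‖u‖ = 1) (hv : ‖v‖ = 1) (huv : u ≠ v) (huv' : u ≠ -v) :
    ∃ w : Fin 3 → V, (∀ a, ‖w a‖ = 1) ∧ ∀ {W : Type*} [NormedAddCommGroup W]
      [InnerProductSpace ℝ W] (L : V →ₗ[ℝ] W) {ε : ℝ}, 0 < ε → ε ≤ 1 / 4 →
      (∀ a, |‖L (w a)‖ ^ 2 - 1| ≤ ε / 8) →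
      (1 - ε) * InnerProductGeometry.angle u v ≤ InnerProductGeometry.angle (L u) (L v) ∧
        InnerProductGeometry.angle (L u) (L v) ≤ (1 + ε) * InnerProductGeometry.angle u v := by
  have hx : 0 < ‖u + v‖ := norm_pos_iff.2 fun h => huv' (eq_neg_of_add_eq_zero_left h)
  have hy : 0 < ‖u - v‖ := norm_pos_iff.2 (sub_ne_zero.2 huv)
  set p := ‖u + v‖⁻¹ • (u + v) with hp
  set q := ‖u - v‖⁻¹ • (u - v) with hq
  have hp1 : ‖p‖ = 1 := by
    rw [hp, norm_smul, norm_inv, norm_norm, inv_mul_cancel₀ hx.ne']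
  have hq1 : ‖q‖ = 1 := by
    rw [hq, norm_smul, norm_inv, norm_norm, inv_mul_cancel₀ hy.ne']
  have hpq : inner ℝ p q = 0 := by
    rw [hp, hq, real_inner_smul_left, real_inner_smul_right,
      (real_inner_add_sub_eq_zero_iff u v).2 (by rw [hu, hv]), mul_zero, mul_zero]
  have hr : ‖p + q‖ ^ 2 = 2 := by
    rw [norm_add_sq_real, hp1, hq1, hpq]; norm_num
  have hr' : ‖p + q‖ = √2 := by rw [← hr, Real.sqrt_sq (norm_nonneg _)]
  have hcs : (‖u + v‖ / 2) ^ 2 + (‖u - v‖ / 2) ^ 2 = 1 := by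
    have := parallelogram_law_with_norm ℝ u v
    rw [hu, hv] at this
    linarith
  have hup : (‖u + v‖ / 2) • p = (2 : ℝ)⁻¹ • (u + v) := by
    rw [hp, smul_smul]; congr 1; field_simp
  have hvq : (‖u - v‖ / 2) • q = (2 : ℝ)⁻¹ • (u - v) := by
    rw [hq, smul_smul]; congr 1; field_simp
  have hu' : (‖u + v‖ / 2) • p + (‖u - v‖ / 2) • q = u := by rw [hup, hvq]; module
  have hv' : (‖u + v‖ / 2) • p - (‖u - v‖ / 2) • q = v := by rw [hup, hvq]; module
  refine ⟨![p, q, (√2)⁻¹ • (p + q)], ?_, fun {W} _ _ L ε hε hε' h => ?_⟩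
  · intro a
    fin_cases a
    · exact hp1
    · exact hq1
    · change ‖(√2)⁻¹ • (p + q)‖ = 1
      rw [norm_smul, hr', norm_inv, Real.norm_of_nonneg (Real.sqrt_nonneg 2),
        inv_mul_cancel₀ (by positivity)]
  · have h3 : |‖L ((√2)⁻¹ • (p + q))‖ ^ 2 - 1| ≤ ε / 8 := h 2
    rw [map_smul, norm_smul, mul_pow, norm_inv, Real.norm_of_nonneg (Real.sqrt_nonneg 2), inv_pow,
      Real.sq_sqrt zero_le_two, inv_mul_eq_div] at h3
    have := angle_map_bounds L hp1 hq1 hpq (half_pos hx) (half_pos hy) hcs hε hε' (h 0) (h 1) h3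
    rwa [hu', hv'] at this

/-! ### Gaussian integrals. -/

theorem lintegral_exp_neg_pi_mul_sum {N : ℕ} {b : Fin N → ℝ} (hb : ∀ i, 0 < b i) :
    ∫⁻ x : E N, ENNReal.ofReal (Real.exp (-Real.pi * ∑ i, b i * x i ^ 2)) =
      ENNReal.ofReal (∏ i, (√(b i))⁻¹) := by
  have hpi : ∀ i, 0 < Real.pi * b i := fun i => mul_pos Real.pi_pos (hb i)
  have hint : Integrable fun x : Fin N → ℝ => ∏ i, Real.exp (-(Real.pi * b i) * x i ^ 2) :=
    Integrable.fintype_prod (f := fun i (t : ℝ) => Real.exp (-(Real.pi * b i) * t ^ 2))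
      fun i => integrable_exp_neg_mul_sq (hpi i)
  have hprod : ∀ x : Fin N → ℝ, Real.exp (-Real.pi * ∑ i, b i * x i ^ 2) =
      ∏ i, Real.exp (-(Real.pi * b i) * x i ^ 2) := fun x => by
    rw [← Real.exp_sum, Finset.mul_sum]
    congr 1
    exact Finset.sum_congr rfl fun i _ => by ring
  calc ∫⁻ x : E N, ENNReal.ofReal (Real.exp (-Real.pi * ∑ i, b i * x i ^ 2))
      = ∫⁻ x : Fin N → ℝ, ENNReal.ofReal (Real.exp (-Real.pi * ∑ i, b i * x i ^ 2)) :=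
        (PiLp.volume_preserving_ofLp (Fin N)).lintegral_comp
          (f := fun x : Fin N → ℝ => ENNReal.ofReal (Real.exp (-Real.pi * ∑ i, b i * x i ^ 2)))
          (by fun_prop)
    _ = ENNReal.ofReal (∏ i, (√(b i))⁻¹) := by
        simp_rw [hprod]
        rw [← ofReal_integral_eq_lintegral_ofReal hint
          (Filter.Eventually.of_forall fun x => by positivity),
          integral_fintype_prod_volume_eq_prod (fun i (t : ℝ) => Real.exp (-(Real.pi * b i) * t ^ 2))]
        congr 1
        refine Finset.prod_congr rfl fun i _ => ?_
        rw [integral_gaussian, div_mul_cancel_left₀ Real.pi_pos.ne', Real.sqrt_inv]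

/-- The density of a Gaussian probability measure on `ℝ^N` that is invariant under rotations. -/
noncomputable def gaussDensity {N : ℕ} (x : E N) : ENNReal :=
  ENNReal.ofReal (Real.exp (-Real.pi * ‖x‖ ^ 2))

theorem measurable_gaussDensity {N : ℕ} : Measurable (gaussDensity : E N → ENNReal) := by
  unfold gaussDensity
  fun_prop

theorem lintegral_gaussDensity {N : ℕ} : ∫⁻ x : E N, gaussDensity x = 1 := by
  have := lintegral_exp_neg_pi_mul_sum (N := N) (b := fun _ => 1) fun _ => one_pos
  simpa [gaussDensity, EuclideanSpace.real_norm_sq_eq] using this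

/-! ### From Haar measure to the Gaussian measure. -/

theorem exists_unitary_apply_eq {N : ℕ} {x y : E N} (h : ‖x‖ = ‖y‖) :
    ∃ V : O N, (V : E N →L[ℝ] E N) x = y :=
  ⟨Unitary.linearIsometryEquiv.symm (Submodule.reflection (ℝ ∙ (x - y))ᗮ),
    Submodule.reflection_sub h⟩

theorem haar_star_apply_mem_eq {N : ℕ} {x y : E N} (h : ‖x‖ = ‖y‖) {S : Set (E N)} :
    Measure.haarMeasure (⊤ : TopologicalSpace.PositiveCompacts (O N))
        {U | ((star U : O N) : E N →L[ℝ] E N) x ∈ S} =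
      Measure.haarMeasure (⊤ : TopologicalSpace.PositiveCompacts (O N))
        {U | ((star U : O N) : E N →L[ℝ] E N) y ∈ S} := by
  obtain ⟨V, hV⟩ := exists_unitary_apply_eq h
  have h1 : ∀ U : O N,
      ((star (V * U) : O N) : E N →L[ℝ] E N) y = ((star U : O N) : E N →L[ℝ] E N) x := by
    intro U
    rw [← hV, star_mul]
    change ((star U : O N) : E N →L[ℝ] E N)
      (((star V * V : O N) : E N →L[ℝ] E N) x) = _
    rw [Unitary.star_mul_self]
    rfl
  refine Eq.trans ?_ (measure_preimage_mul _ V _)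
  congr 1
  ext U
  exact Iff.of_eq (congrArg (· ∈ S) (h1 U).symm)

/-- Integrate the indicator of `star U x ∈ S` over Haar times Gaussian in both orders. For fixed `x
≠ 0`, the cone property and transitivity on spheres replace `x` by `y`; for fixed `U`, rotation
invariance of the Gaussian removes `U`. -/
theorem haar_star_apply_mem_cone {N : ℕ} {S : Set (E N)} (hS : MeasurableSet S)
    (hcone : ∀ (c : ℝ) (x : E N), 0 < c → (c • x ∈ S ↔ x ∈ S)) {y : E N} (hy : ‖y‖ = 1) :
    Measure.haarMeasure (⊤ : TopologicalSpace.PositiveCompacts (O N))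
        {U | ((star U : O N) : E N →L[ℝ] E N) y ∈ S} = ∫⁻ x in S, gaussDensity x := by
  set μ := Measure.haarMeasure (⊤ : TopologicalSpace.PositiveCompacts (O N)) with hμ
  have hprob : IsProbabilityMeasure μ :=
    ⟨by simpa using Measure.haarMeasure_self (K₀ := (⊤ : TopologicalSpace.PositiveCompacts (O N)))⟩
  have hvol : volume ({0} : Set (E N)) = 0 := by
    have : Nontrivial (E N) := ⟨y, 0, fun h => by simp [h] at hy⟩
    exact measure_singleton 0
  have hstar : Continuous fun U : O N => ((star U : O N) : E N →L[ℝ] E N) := by fun_prop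
  have hmeas : Measurable fun z : O N × E N => ((star z.1 : O N) : E N →L[ℝ] E N) z.2 := by
    exact ((hstar.comp continuous_fst).clm_apply continuous_snd).measurable
  set F : O N → E N → ENNReal := fun U x =>
    S.indicator 1 (((star U : O N) : E N →L[ℝ] E N) x) * gaussDensity x with hF
  have hFm : Measurable (Function.uncurry F) :=
    ((measurable_one.indicator hS).comp hmeas).mul (measurable_gaussDensity.comp measurable_snd)
  have h1 : ∀ x : E N, x ≠ 0 → ∫⁻ U, F U x ∂μ =
      μ {U | ((star U : O N) : E N →L[ℝ] E N) y ∈ S} * gaussDensity x := by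
    intro x hx
    have hx' := norm_pos_iff.2 hx
    have hm : Measurable fun U : O N => ((star U : O N) : E N →L[ℝ] E N) x :=
      (hstar.clm_apply continuous_const).measurable
    have hmi : Measurable fun U : O N =>
        S.indicator (1 : E N → ENNReal) (((star U : O N) : E N →L[ℝ] E N) x) :=
      (measurable_one.indicator hS).comp hm
    simp only [hF]
    rw [lintegral_mul_const _ hmi]
    congr 1
    have : (fun U : O N => S.indicator (1 : E N → ENNReal) (((star U : O N) : E N →L[ℝ] E N) x)) =
        ((fun U : O N => ((star U : O N) : E N →L[ℝ] E N) x) ⁻¹' S).indicator 1 := by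
      ext U; rfl
    rw [this, lintegral_indicator_one (hm hS)]
    clear_value F
    have hn : ‖‖x‖ • y‖ = ‖x‖ := by rw [norm_smul, hy, norm_norm, mul_one]
    rw [hμ]
    refine (haar_star_apply_mem_eq hn.symm).trans ?_
    congr 1
    ext U
    change ((star U : O N) : E N →L[ℝ] E N) (‖x‖ • y) ∈ S ↔ _
    rw [map_smul]
    exact hcone _ _ hx'
  have h2 : ∀ U : O N, ∫⁻ x, F U x = ∫⁻ x in S, gaussDensity x := by
    intro U
    have hmp := (Unitary.linearIsometryEquiv (star U)).measurePreserving
    have := hmp.lintegral_comp (f := S.indicator gaussDensity)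
      (measurable_gaussDensity.indicator hS)
    rw [lintegral_indicator hS] at this
    rw [← this]
    refine lintegral_congr fun x => ?_
    have hx : (Unitary.linearIsometryEquiv (star U)) x = ((star U : O N) : E N →L[ℝ] E N) x := rfl
    have hg : gaussDensity ((Unitary.linearIsometryEquiv (star U)) x) = gaussDensity x := by
      rw [gaussDensity, LinearIsometryEquiv.norm_map, gaussDensity]
    simp only [hF]
    rw [← hx]
    by_cases hxS : (Unitary.linearIsometryEquiv (star U)) x ∈ S
    · rw [Set.indicator_of_mem hxS, Set.indicator_of_mem hxS, hg, Pi.one_apply, one_mul]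
    · rw [Set.indicator_of_notMem hxS, Set.indicator_of_notMem hxS, zero_mul]
  calc μ {U | ((star U : O N) : E N →L[ℝ] E N) y ∈ S}
      = ∫⁻ x, μ {U | ((star U : O N) : E N →L[ℝ] E N) y ∈ S} * gaussDensity x := by
        rw [lintegral_const_mul _ (measurable_gaussDensity (N := N)), lintegral_gaussDensity, mul_one]
    _ = ∫⁻ x, ∫⁻ U, F U x ∂μ := by
        refine lintegral_congr_ae ?_
        have : ∀ᵐ x : E N, x ≠ 0 := by
          rw [ae_iff]; simpa using hvol
        filter_upwards [this] with x hx using (h1 x hx).symm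
    _ = ∫⁻ U, (∫⁻ x, F U x) ∂μ := (lintegral_lintegral_swap hFm.aemeasurable).symm
    _ = ∫⁻ x in S, gaussDensity x := by
        simp_rw [h2]
        rw [lintegral_const, measure_univ, mul_one]

/-! ### The law of the squared norm of a projection. -/

theorem proj_std_apply {N m : ℕ} (h : m ≤ N) (x : E N) :
    (Gr.std h).proj x = WithLp.toLp 2 fun i : Fin N => if i.val < m then x i else 0 := by
  set t : E N := WithLp.toLp 2 fun i : Fin N => if i.val < m then x i else 0 with ht
  rw [Gr.proj]
  refine Submodule.eq_starProjection_of_mem_orthogonal (K := (Gr.std h).1) (u := x) (v := t)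
    ?_ ?_
  · have : t = ∑ j : Fin m, x (Fin.castLE h j) •
        EuclideanSpace.basisFun (Fin N) ℝ (Fin.castLE h j) := by
      ext i
      simp only [ht, WithLp.ofLp_sum, WithLp.ofLp_smul, Finset.sum_apply, Pi.smul_apply,
        EuclideanSpace.basisFun_apply, PiLp.single_apply, smul_eq_mul, mul_ite, mul_one, mul_zero]
      split_ifs with hi
      · rw [Finset.sum_eq_single ⟨i.val, hi⟩]
        · simp
        · intro j _ hj
          have hij : i ≠ Fin.castLE h j := fun hij => hj (Fin.ext (congrArg Fin.val hij).symm)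
          exact if_neg hij
        · simp
      · refine (Finset.sum_eq_zero fun j _ => if_neg fun hij => hi ?_).symm
        rw [hij]; exact j.2
    rw [this]
    exact Submodule.sum_mem _ fun j _ => Submodule.smul_mem _ _
      (Submodule.subset_span (Set.mem_range_self j))
  · rw [Gr.std, Submodule.mem_orthogonal]
    intro u hu
    induction hu using Submodule.span_induction with
    | mem u hu =>
      obtain ⟨j, rfl⟩ := hu
      beta_reduce
      rw [EuclideanSpace.basisFun_apply, EuclideanSpace.inner_single_left]
      simp [ht]
    | zero => simp
    | add a b _ _ ha hb => rw [inner_add_left, ha, hb, add_zero]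
    | smul c a _ ha => rw [inner_smul_left, ha, mul_zero]

theorem norm_proj_std_sq {N m : ℕ} (h : m ≤ N) (x : E N) :
    ‖(Gr.std h).proj x‖ ^ 2 = ∑ i : Fin N, if i.val < m then x i ^ 2 else 0 := by
  rw [proj_std_apply, EuclideanSpace.real_norm_sq_eq]
  refine Finset.sum_congr rfl fun i _ => ?_
  dsimp only
  split_ifs <;> simp

/-- The projection onto `U H₀` is `U P star U`, so its value at `y` has the norm of `P (star U y)`.
Dividing by `‖x‖ ^ 2` makes the event a cone. -/
theorem uniformGr_norm_proj_sq_mem {N m : ℕ} (h : m ≤ N) {y : E N} (hy : ‖y‖ = 1) {T : Set ℝ}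
    (hT : MeasurableSet T) :
    uniformGr h {H | ‖H.proj y‖ ^ 2 ∈ T} =
      ∫⁻ x in {x | ‖(Gr.std h).proj x‖ ^ 2 / ‖x‖ ^ 2 ∈ T}, gaussDensity x := by
  have hproj : Measurable (Gr.proj : Gr N m → E N →L[ℝ] E N) := comap_measurable _
  have hm : Measurable fun H : Gr N m => ‖H.proj y‖ ^ 2 := by
    have : Continuous fun A : E N →L[ℝ] E N => ‖A y‖ ^ 2 := by fun_prop
    exact this.measurable.comp hproj
  have hset : MeasurableSet {H : Gr N m | ‖H.proj y‖ ^ 2 ∈ T} := hm hT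
  rw [uniformGr, Measure.map_apply (measurable_rotate _) hset,
    ← haar_star_apply_mem_cone (y := y) _ _ hy]
  · congr 1
    ext U
    change ‖(Gr.rotate U (Gr.std h)).proj y‖ ^ 2 ∈ T ↔
      ‖(Gr.std h).proj (((star U : O N) : E N →L[ℝ] E N) y)‖ ^ 2 /
        ‖((star U : O N) : E N →L[ℝ] E N) y‖ ^ 2 ∈ T
    rw [proj_rotate]
    have h1 : ∀ (U : O N) z, ‖(U : E N →L[ℝ] E N) z‖ = ‖z‖ := fun U z =>
      (Unitary.linearIsometryEquiv U).norm_map z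
    change ‖(U : E N →L[ℝ] E N) ((Gr.std h).proj (((star U : O N) : E N →L[ℝ] E N) y))‖ ^ 2 ∈ T ↔ _
    rw [h1, h1, hy, one_pow, div_one]
  · have : Measurable fun x : E N => ‖(Gr.std h).proj x‖ ^ 2 / ‖x‖ ^ 2 := by fun_prop
    exact this hT
  · intro c x hc
    change ‖(Gr.std h).proj (c • x)‖ ^ 2 / ‖c • x‖ ^ 2 ∈ T ↔ _
    rw [map_smul, norm_smul, norm_smul, mul_pow, mul_pow]
    rw [mul_div_mul_left _ _ (pow_ne_zero 2 (norm_ne_zero_iff.2 hc.ne'))]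
    rfl

theorem norm_proj_std_sq_le {N m : ℕ} (h : m ≤ N) (x : E N) :
    ‖(Gr.std h).proj x‖ ^ 2 ≤ ‖x‖ ^ 2 :=
  pow_le_pow_left₀ (norm_nonneg _) ((Gr.std h).1.norm_starProjection_apply_le x) 2

/-! ### Tail bounds. -/

/-- On `S` the Gaussian density is dominated by an anisotropic one, whose integral over the whole
space is explicit. -/
theorem setLIntegral_gaussDensity_le {N m : ℕ} (h : m ≤ N) {b₁ b₂ : ℝ} (hb₁ : 0 < b₁)
    (hb₂ : 0 < b₂) {S : Set (E N)}
    (hS : ∀ x ∈ S, b₁ * ‖(Gr.std h).proj x‖ ^ 2 + b₂ * (‖x‖ ^ 2 - ‖(Gr.std h).proj x‖ ^ 2) ≤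
      ‖x‖ ^ 2) :
    ∫⁻ x in S, gaussDensity x ≤ ENNReal.ofReal ((√b₁)⁻¹ ^ m * (√b₂)⁻¹ ^ (N - m)) := by
  set b : Fin N → ℝ := fun i => if i.val < m then b₁ else b₂ with hb
  have hquad : ∀ x : E N, ∑ i, b i * x i ^ 2 =
      b₁ * ‖(Gr.std h).proj x‖ ^ 2 + b₂ * (‖x‖ ^ 2 - ‖(Gr.std h).proj x‖ ^ 2) := by
    intro x
    rw [norm_proj_std_sq, EuclideanSpace.real_norm_sq_eq, ← Finset.sum_sub_distrib,
      Finset.mul_sum, Finset.mul_sum, ← Finset.sum_add_distrib]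
    refine Finset.sum_congr rfl fun i _ => ?_
    simp only [hb]
    split_ifs <;> ring
  have hprod : ∏ i, (√(b i))⁻¹ = (√b₁)⁻¹ ^ m * (√b₂)⁻¹ ^ (N - m) := by
    obtain ⟨l, rfl⟩ := Nat.exists_eq_add_of_le h
    rw [Fin.prod_univ_add]
    simp [hb]
  rw [← hprod, ← lintegral_exp_neg_pi_mul_sum fun i => by simp only [hb]; split_ifs <;> assumption]
  have hm : Measurable fun x : E N =>
      ENNReal.ofReal (Real.exp (-Real.pi * ∑ i, b i * x i ^ 2)) := by fun_prop
  refine (setLIntegral_mono hm fun x hx => ?_).trans (setLIntegral_le_lintegral _ _)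
  refine ENNReal.ofReal_le_ofReal (Real.exp_le_exp.2 ?_)
  rw [hquad]
  nlinarith [hS x hx, Real.pi_pos]

/-- Apply `1 + t ≤ exp t` to `√β = 1 + (√β - 1)` and to the other radicand; the exponents add up to
a square. -/
theorem sqrt_pow_mul_sqrt_pow_le {M m β p : ℝ} {k l : ℕ} (hk : (k : ℝ) = m) (hl : (l : ℝ) = M - m)
    (hm : 0 ≤ m) (hmM : m < M) (hp : p = m / M) (hβ : 0 < β) :
    √β ^ k * √((1 - β * p) / (1 - p)) ^ l ≤ Real.exp (-(m * (√β - 1) ^ 2 / 2)) := by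
  have hM : 0 < M := hm.trans_lt hmM
  have hMm : 0 < M - m := sub_pos.2 hmM
  have h1 : √β ^ k ≤ Real.exp (m * (√β - 1)) := by
    rw [← hk, Real.exp_nat_mul]
    exact pow_le_pow_left₀ (Real.sqrt_nonneg _) (by linarith [Real.add_one_le_exp (√β - 1)]) _
  have hfrac : (1 - β * p) / (1 - p) = (1 - β) * m / (M - m) + 1 := by
    have : 1 - p = (M - m) / M := by rw [hp]; field_simp
    rw [this, hp]
    field_simp
    ring
  have h2 : √((1 - β * p) / (1 - p)) ^ l ≤ Real.exp (m * (1 - β) / 2) := by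
    have h3 : √((1 - β * p) / (1 - p)) ≤ Real.exp ((1 - β) * m / (M - m) / 2) := by
      rw [Real.exp_half]
      refine Real.sqrt_le_sqrt ?_
      rw [hfrac]
      exact Real.add_one_le_exp _
    calc √((1 - β * p) / (1 - p)) ^ l ≤ Real.exp ((1 - β) * m / (M - m) / 2) ^ l :=
          pow_le_pow_left₀ (Real.sqrt_nonneg _) h3 _
      _ = Real.exp (m * (1 - β) / 2) := by
          rw [← Real.exp_nat_mul, hl]
          congr 1
          field_simp
  calc _ ≤ Real.exp (m * (√β - 1)) * Real.exp (m * (1 - β) / 2) :=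
        mul_le_mul h1 h2 (by positivity) (Real.exp_pos _).le
    _ = Real.exp (-(m * (√β - 1) ^ 2 / 2)) := by
        rw [← Real.exp_add]
        congr 1
        linear_combination (m / 2) * Real.sq_sqrt hβ.le

/-- The hypothesis on `S` covers both tails: the lower one for `β < 1`, the upper one for `β > 1`.
-/
theorem setLIntegral_gaussDensity_le_exp {N m : ℕ} (h : m < N) {β : ℝ} (hβ : 0 < β)
    (hβp : β * (m / N : ℝ) < 1) {S : Set (E N)}
    (hS : ∀ x ∈ S, (1 - β) * (β * (m / N : ℝ) * ‖x‖ ^ 2 - ‖(Gr.std h.le).proj x‖ ^ 2) ≥ 0) :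
    ∫⁻ x in S, gaussDensity x ≤ ENNReal.ofReal (Real.exp (-(m * (√β - 1) ^ 2 / 2))) := by
  have hN : (0 : ℝ) < N := by exact_mod_cast (Nat.zero_le m).trans_lt h
  have hmN : (m : ℝ) < N := by exact_mod_cast h
  set p : ℝ := m / N with hp
  have hp0 : 0 ≤ p := by positivity
  have hp1 : 0 < 1 - p := by rw [hp, sub_pos, div_lt_one hN]; exact hmN
  have hβ1 : 0 < 1 - β * p := by linarith
  have hb₂ : 0 < (1 - p) / (1 - β * p) := div_pos hp1 hβ1
  -- With these weights the quadratic form equals `‖x‖ ^ 2` exactly on the boundary `‖P x‖ ^ 2 = β *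
  -- p * ‖x‖ ^ 2`.
  refine (setLIntegral_gaussDensity_le h.le (inv_pos.2 hβ) hb₂ fun x hx => ?_).trans
    (ENNReal.ofReal_le_ofReal ?_)
  · have hx' := hS x hx
    set X := ‖(Gr.std h.le).proj x‖ ^ 2
    have hkey : β⁻¹ * X + (1 - p) / (1 - β * p) * (‖x‖ ^ 2 - X) =
        ‖x‖ ^ 2 - (1 - β) * (β * p * ‖x‖ ^ 2 - X) / (β * (1 - β * p)) := by
      field_simp
      ring
    rw [hkey]
    have := div_nonneg hx' (mul_pos hβ hβ1).le
    linarith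
  · rw [← Real.sqrt_inv, ← Real.sqrt_inv, inv_inv, inv_div]
    exact sqrt_pow_mul_sqrt_pow_le rfl (by rw [Nat.cast_sub h.le]) (Nat.cast_nonneg m) hmN hp hβ

theorem sq_sqrt_sub_one_ge {β : ℝ} (hβ : 0 ≤ β) (hβ' : β ≤ 2) :
    (β - 1) ^ 2 / 9 ≤ (√β - 1) ^ 2 := by
  have h1 : √β ≤ 2 := Real.sqrt_le_iff.2 ⟨by norm_num, by linarith⟩
  have h0 := Real.sqrt_nonneg β
  have h2 : (β - 1) ^ 2 = (√β - 1) ^ 2 * (√β + 1) ^ 2 := by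
    rw [← mul_pow]
    congr 1
    linear_combination -Real.sq_sqrt hβ
  have h3 : (√β + 1) ^ 2 ≤ 9 := by nlinarith
  rw [h2]
  nlinarith [mul_le_mul_of_nonneg_left h3 (sq_nonneg (√β - 1))]

theorem uniformGr_norm_proj_sq_lt_le {N m : ℕ} (h : m ≤ N) (hm : 0 < m) {y : E N} (hy : ‖y‖ = 1)
    {η : ℝ} (hη : 0 < η) (hη' : η < 1) :
    uniformGr h {H | ‖H.proj y‖ ^ 2 < (1 - η) * (m / N : ℝ)} ≤
      ENNReal.ofReal (Real.exp (-(m * η ^ 2 / 18))) := by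
  have hN : (0 : ℝ) < N := by exact_mod_cast hm.trans_le h
  have hm' : (0 : ℝ) < m := by exact_mod_cast hm
  have hmN : (m : ℝ) ≤ N := by exact_mod_cast h
  have hp1 : (m / N : ℝ) ≤ 1 := (div_le_one hN).2 hmN
  have hp0 : (0 : ℝ) < m / N := by positivity
  refine (uniformGr_norm_proj_sq_mem h hy measurableSet_Iio).trans_le ?_
  rcases h.lt_or_eq with h | rfl
  · refine (setLIntegral_gaussDensity_le_exp h (β := 1 - η) (by linarith) (by nlinarith)
      fun x hx => ?_).trans (ENNReal.ofReal_le_ofReal (Real.exp_le_exp.2 ?_))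
    · refine mul_nonneg (by linarith) (sub_nonneg.2 ?_)
      rcases eq_or_ne x 0 with rfl | h0
      · simp
      · have hx0 := norm_pos_iff.2 h0
        exact (div_le_iff₀ (by positivity)).1 (le_of_lt hx)
    · have := sq_sqrt_sub_one_ge (β := 1 - η) (by linarith) (by linarith)
      have h2 := mul_le_mul_of_nonneg_left this hm'.le
      nlinarith
  -- For `m = N` the projection is the identity, so the event lies in `{0}`.
  · refine (setLIntegral_measure_zero _ _ (measure_mono_null (t := {0}) (fun x hx => ?_) ?_)).trans_le
      bot_le
    · by_contra h0
      have hx0 : 0 < ‖x‖ := norm_pos_iff.2 h0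
      have hx' : ‖(Gr.std h).proj x‖ ^ 2 / ‖x‖ ^ 2 < (1 - η) * (m / m : ℝ) := hx
      have hp : ‖(Gr.std h).proj x‖ ^ 2 = ‖x‖ ^ 2 := by
        rw [norm_proj_std_sq, EuclideanSpace.real_norm_sq_eq]
        exact Finset.sum_congr rfl fun i _ => if_pos i.2
      rw [hp, div_self (by positivity), div_self hm'.ne'] at hx'
      linarith
    · have : Nontrivial (E m) := ⟨y, 0, fun h => by simp [h] at hy⟩
      exact measure_singleton 0

theorem uniformGr_lt_norm_proj_sq_le {N m : ℕ} (h : m ≤ N) (hm : 0 < m) {y : E N} (hy : ‖y‖ = 1)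
    {η : ℝ} (hη : 0 < η) (hη' : η < 1) :
    uniformGr h {H | (1 + η) * (m / N : ℝ) < ‖H.proj y‖ ^ 2} ≤
      ENNReal.ofReal (Real.exp (-(m * η ^ 2 / 18))) := by
  have hN : (0 : ℝ) < N := by exact_mod_cast hm.trans_le h
  have hm' : (0 : ℝ) < m := by exact_mod_cast hm
  have hp0 : (0 : ℝ) < m / N := by positivity
  refine (uniformGr_norm_proj_sq_mem h hy measurableSet_Ioi).trans_le ?_
  rcases lt_or_ge ((1 + η) * (m / N : ℝ)) 1 with h1 | h1
  · have hlt : m < N := by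
      have : (m / N : ℝ) < 1 := by nlinarith
      exact_mod_cast (div_lt_one hN).1 this
    refine (setLIntegral_gaussDensity_le_exp hlt (β := 1 + η) (by linarith) h1
      fun x hx => ?_).trans (ENNReal.ofReal_le_ofReal (Real.exp_le_exp.2 ?_))
    · refine mul_nonneg_of_nonpos_of_nonpos (by linarith) (sub_nonpos.2 ?_)
      rcases eq_or_ne x 0 with rfl | h0
      · simp
      · have hx0 := norm_pos_iff.2 h0
        exact (le_div_iff₀ (by positivity)).1 (le_of_lt hx)
    · have := sq_sqrt_sub_one_ge (β := 1 + η) (by linarith) (by linarith)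
      have h2 := mul_le_mul_of_nonneg_left this hm'.le
      nlinarith
  · have : {x : E N | ‖(Gr.std h).proj x‖ ^ 2 / ‖x‖ ^ 2 ∈ Set.Ioi ((1 + η) * (m / N : ℝ))} = ∅ := by
      refine Set.eq_empty_of_forall_notMem fun x hx => ?_
      have h2 : ‖(Gr.std h).proj x‖ ^ 2 / ‖x‖ ^ 2 ≤ 1 :=
        div_le_one_of_le₀ (norm_proj_std_sq_le h x) (sq_nonneg _)
      exact absurd (h1.trans_lt hx) (not_lt.2 h2)
    rw [this, setLIntegral_empty]
    exact bot_le

/-- The kernel of the coordinate projection is a proper subspace, hence Lebesgue-null. -/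
theorem uniformGr_norm_proj_eq_zero {N m : ℕ} (h : m ≤ N) (hm : 0 < m) {y : E N} (hy : ‖y‖ = 1) :
    uniformGr h {H | H.proj y = 0} = 0 := by
  have h1 : {H : Gr N m | H.proj y = 0} = {H | ‖H.proj y‖ ^ 2 ∈ ({0} : Set ℝ)} := by
    ext H
    change H.proj y = 0 ↔ ‖H.proj y‖ ^ 2 = 0
    rw [sq_eq_zero_iff, norm_eq_zero]
  rw [h1, uniformGr_norm_proj_sq_mem h hy (measurableSet_singleton 0)]
  refine setLIntegral_measure_zero _ _ ?_
  set K : Submodule ℝ (E N) := LinearMap.ker ((Gr.std h).proj : E N →ₗ[ℝ] E N) with hK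
  refine measure_mono_null (t := (K : Set (E N))) ?_ (Measure.addHaar_submodule _ _ ?_)
  · intro x hx
    have hx' : ‖(Gr.std h).proj x‖ ^ 2 / ‖x‖ ^ 2 = 0 := hx
    change (Gr.std h).proj x = 0
    rcases div_eq_zero_iff.1 hx' with h0 | h0
    · simpa using h0
    · have : x = 0 := by simpa using h0
      rw [this, map_zero]
  · intro htop
    have h2 : ∀ x ∈ (Gr.std h).1, x = 0 := fun x hx => by
      have h3 : x ∈ K := htop ▸ Submodule.mem_top
      have h4 : (Gr.std h).1.starProjection x = x := Submodule.starProjection_eq_self_iff.2 hx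
      exact h4 ▸ h3
    have h5 : (Gr.std h).1 = ⊥ := (Submodule.eq_bot_iff _).2 h2
    have h6 := (Gr.std h).2
    rw [h5, finrank_bot] at h6
    omega

theorem uniformGr_distortion_le {N m : ℕ} (h : m ≤ N) (hm : 0 < m) {y : E N} (hy : ‖y‖ = 1)
    {η : ℝ} (hη : 0 < η) (hη' : η < 1) :
    uniformGr h {H | η < |‖H.proj y‖ ^ 2 * (N / m : ℝ) - 1|} ≤
      ENNReal.ofReal (2 * Real.exp (-(m * η ^ 2 / 18))) := by
  have hN : (0 : ℝ) < N := by exact_mod_cast hm.trans_le h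
  have hm' : (0 : ℝ) < m := by exact_mod_cast hm
  rw [two_mul, ENNReal.ofReal_add (Real.exp_pos _).le (Real.exp_pos _).le]
  refine le_trans (measure_mono ?_) ((measure_union_le _ _).trans
    (add_le_add (uniformGr_norm_proj_sq_lt_le h hm hy hη hη')
      (uniformGr_lt_norm_proj_sq_le h hm hy hη hη')))
  intro H hH
  have hm0 : ‖H.proj y‖ ^ 2 = ‖H.proj y‖ ^ 2 * (N / m : ℝ) * (m / N : ℝ) := by
    field_simp
  have hp0 : (0 : ℝ) < m / N := by positivity
  rcases lt_abs.1 (show η < |‖H.proj y‖ ^ 2 * (N / m : ℝ) - 1| from hH) with h1 | h1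
  · right
    change (1 + η) * (m / N : ℝ) < ‖H.proj y‖ ^ 2
    rw [hm0]
    exact mul_lt_mul_of_pos_right (by linarith) hp0
  · left
    change ‖H.proj y‖ ^ 2 < (1 - η) * (m / N : ℝ)
    rw [hm0]
    exact mul_lt_mul_of_pos_right (by linarith) hp0

/-! ### Geodesic distances of the projected points. -/

theorem angle_toUnit_scaledProj {N m : ℕ} (hm : 0 < m) (hN : 0 < N) (H : Gr N m) {u v : E N}
    (hu : scaledProj H u ≠ 0) (hv : scaledProj H v ≠ 0) :
    geodesicDist (toUnit (scaledProj H u)) (toUnit (scaledProj H v)) =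
      InnerProductGeometry.angle (H.1.orthogonalProjectionOnto u)
        (H.1.orthogonalProjectionOnto v) := by
  have hp : (0 : ℝ) < N / m := div_pos (Nat.cast_pos.2 hN) (Nat.cast_pos.2 hm)
  rw [geodesicDist, toUnit, toUnit,
    InnerProductGeometry.angle_smul_left_of_pos _ _ (inv_pos.2 (norm_pos_iff.2 hu)),
    InnerProductGeometry.angle_smul_right_of_pos _ _ (inv_pos.2 (norm_pos_iff.2 hv)),
    scaledProj, scaledProj, InnerProductGeometry.angle_smul_smul hp.ne']

theorem exists_unit_vectors_angle_bounds {N m : ℕ} (hm : 0 < m) (hN : 0 < N) {u v : E N}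
    (hu : ‖u‖ = 1) (hv : ‖v‖ = 1) :
    ∃ w : Fin 3 → E N, (∀ a, ‖w a‖ = 1) ∧ ∀ (H : Gr N m) {ε : ℝ}, 0 < ε → ε ≤ 1 / 4 →
      scaledProj H u ≠ 0 → scaledProj H v ≠ 0 →
      (∀ a, |‖H.proj (w a)‖ ^ 2 * (N / m : ℝ) - 1| ≤ ε / 8) →
      (1 - ε) * geodesicDist u v ≤
          geodesicDist (toUnit (scaledProj H u)) (toUnit (scaledProj H v)) ∧
        geodesicDist (toUnit (scaledProj H u)) (toUnit (scaledProj H v)) ≤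
          (1 + ε) * geodesicDist u v := by
  have hu0 : u ≠ 0 := fun h => by simp [h] at hu
  have hv0 : v ≠ 0 := fun h => by simp [h] at hv
  have hproj : ∀ (H : Gr N m) {x : E N}, scaledProj H x ≠ 0 → H.1.orthogonalProjectionOnto x ≠ 0 :=
    fun H x hx h => hx (by rw [scaledProj, h, smul_zero])
  rcases eq_or_ne u v with rfl | huv
  -- Equal and antipodal pairs keep their angle exactly; the test vectors are placeholders.
  · refine ⟨fun _ => u, fun _ => hu, fun H ε hε hε' h1 h2 _ => ?_⟩
    rw [angle_toUnit_scaledProj hm hN H h1 h2, geodesicDist, InnerProductGeometry.angle_self hu0,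
      InnerProductGeometry.angle_self (hproj H h1), mul_zero, mul_zero]
    exact ⟨le_rfl, le_rfl⟩
  rcases eq_or_ne u (-v) with rfl | huv'
  · refine ⟨fun _ => v, fun _ => hv, fun H ε hε hε' h1 h2 _ => ?_⟩
    rw [angle_toUnit_scaledProj hm hN H h1 h2, geodesicDist, map_neg,
      InnerProductGeometry.angle_neg_self_of_nonzero hv0,
      InnerProductGeometry.angle_neg_self_of_nonzero (hproj H h2)]
    constructor <;> nlinarith [Real.pi_pos]
  obtain ⟨w, hw, hL⟩ := angle_map_bounds_of_norm_eq_one hu hv huv huv'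
  have hp : (0 : ℝ) < N / m := div_pos (Nat.cast_pos.2 hN) (Nat.cast_pos.2 hm)
  have hs : (0 : ℝ) < √(N / m) := Real.sqrt_pos.2 hp
  refine ⟨w, hw, fun H ε hε hε' h1 h2 h => ?_⟩
  have hLH := hL (W := H.1) (√(N / m : ℝ) • (H.1.orthogonalProjectionOnto : E N →ₗ[ℝ] H.1)) hε hε'
    fun a => by
      refine le_of_eq_of_le ?_ (h a)
      rw [LinearMap.smul_apply, norm_smul, mul_pow, Real.norm_eq_abs, sq_abs, Real.sq_sqrt hp.le,
        mul_comm]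
      rfl
  rw [LinearMap.smul_apply, LinearMap.smul_apply, InnerProductGeometry.angle_smul_smul hs.ne'] at hLH
  rw [angle_toUnit_scaledProj hm hN H h1 h2]
  exact hLH

/-! ### The union bound. -/

/-- Since `18 * 8 ^ 2 = 1152` and `5760 = 5 * 1152`, each exponential is at most `(δ / n) ^ 5`. The
factor `6` (three vectors, two tails) is absorbed by `n ^ 3 ≥ 8`; for `n < 2` there are no pairs. -/
theorem six_mul_offDiag_mul_exp_le {n k : ℕ} {ε δ : ℝ} (hε : 0 < ε) (hδ : 0 < δ) (hδ' : δ < 1)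
    (hk : 5760 * (1 / ε ^ 2) * Real.log ((n : ℝ) / δ) ≤ (k : ℝ)) :
    ((n * n - n : ℕ) : ℝ) * (3 * (2 * Real.exp (-(((k + 1 : ℕ) : ℝ) * (ε / 8) ^ 2 / 18)))) ≤ δ := by
  rcases Nat.lt_or_ge n 2 with hn | hn
  · have : n * n - n = 0 := by interval_cases n <;> rfl
    rw [this, Nat.cast_zero, zero_mul]
    exact hδ.le
  have hn' : (2 : ℝ) ≤ n := by exact_mod_cast hn
  have hn0 : (0 : ℝ) < n := by linarith
  have hexp : Real.exp (-(((k + 1 : ℕ) : ℝ) * (ε / 8) ^ 2 / 18)) ≤ (δ / n) ^ 5 := by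
    have h1 : 5 * Real.log (n / δ) ≤ ((k + 1 : ℕ) : ℝ) * (ε / 8) ^ 2 / 18 := by
      have h2 := mul_le_mul_of_nonneg_right hk (by positivity : 0 ≤ ε ^ 2 / 1152)
      have h3 : 5760 * (1 / ε ^ 2) * Real.log (n / δ) * (ε ^ 2 / 1152) = 5 * Real.log (n / δ) := by
        field_simp
        ring
      rw [h3] at h2
      push_cast
      nlinarith [sq_nonneg ε]
    have h4 : (δ / n) ^ 5 = Real.exp (-(5 * Real.log (n / δ))) := by
      rw [← inv_div, inv_pow, Real.exp_neg, ← Real.exp_log (div_pos hn0 hδ), ← Real.exp_nat_mul,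
        Real.log_exp]
      norm_num
    rw [h4]
    exact Real.exp_le_exp.2 (neg_le_neg h1)
  have hcard : ((n * n - n : ℕ) : ℝ) ≤ n ^ 2 := by
    rw [sq]
    exact_mod_cast Nat.sub_le _ _
  have h8 : (8 : ℝ) ≤ n ^ 3 := by
    calc (8 : ℝ) = 2 ^ 3 := by norm_num
      _ ≤ n ^ 3 := pow_le_pow_left₀ zero_le_two hn' 3
  calc _ ≤ (n : ℝ) ^ 2 * (3 * (2 * (δ / n) ^ 5)) := by gcongr
    _ = 6 * δ ^ 4 * δ / n ^ 3 := by field_simp; norm_num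
    _ ≤ δ := by
        rw [div_le_iff₀ (by positivity)]
        have : δ ^ 4 ≤ 1 := pow_le_one₀ hδ.le hδ'.le
        nlinarith

end SphericalJL

/-- The probability of failure is at most `δ`; with respect to the outer measure, this is the
strongest form of `the probability of success is at least 1 - δ`. -/
theorem theorem3 :
    ∃ C : ℝ, 0 < C ∧
      ∀ (n d k : ℕ) (ε δ : ℝ), 0 < ε → ε ≤ 1 / 4 → 0 < δ → δ < 1 →
        ∀ hkd : k ≤ d, C * (1 / ε ^ 2) * Real.log ((n : ℝ) / δ) ≤ (k : ℝ) →
          ∀ y : Fin n → Metric.sphere (0 : SphericalJL.E (d + 1)) 1,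
            SphericalJL.uniformGr (Nat.succ_le_succ hkd : k + 1 ≤ d + 1)
              {H | ¬ SphericalJL.ProjectsWithDistortion ε y H} ≤ ENNReal.ofReal δ := by
  refine ⟨5760, by norm_num, fun n d k ε δ hε hε' hδ hδ' hkd hk y => ?_⟩
  have hy : ∀ i, ‖(y i : SphericalJL.E (d + 1))‖ = 1 := fun i => by simp
  have hm : 0 < k + 1 := Nat.succ_pos k
  choose w hw hangle using fun z : Fin n × Fin n =>
    SphericalJL.exists_unit_vectors_angle_bounds hm (Nat.succ_pos d) (hy z.1) (hy z.2)
  set e := Real.exp (-(((k + 1 : ℕ) : ℝ) * (ε / 8) ^ 2 / 18))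
  have hsub : {H : SphericalJL.Gr (d + 1) (k + 1) | ¬ SphericalJL.ProjectsWithDistortion ε y H} ⊆
      (⋃ i, {H | H.proj (y i : SphericalJL.E (d + 1)) = 0}) ∪
        ⋃ z ∈ (Finset.univ : Finset (Fin n)).offDiag, ⋃ a : Fin 3,
          {H | ε / 8 < |‖H.proj (w z a)‖ ^ 2 * (((d + 1 : ℕ) : ℝ) / ((k + 1 : ℕ) : ℝ)) - 1|} := by
    intro H hH
    by_contra hbad
    rw [Set.mem_union, not_or] at hbad
    obtain ⟨hzero, hdist⟩ := hbad
    have hne : ∀ i, SphericalJL.scaledProj H (y i : SphericalJL.E (d + 1)) ≠ 0 := by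
      intro i hi
      refine hzero (Set.mem_iUnion.2 ⟨i, ?_⟩)
      rw [SphericalJL.scaledProj, smul_eq_zero_iff_right (by positivity)] at hi
      exact congrArg Subtype.val hi
    -- Angles are insensitive to the scaling of the projection, so the common constant can be `1`.
    refine hH ⟨hne, 1, one_pos, fun i j => ?_⟩
    rw [one_mul]
    rcases eq_or_ne i j with rfl | hij
    · have h0 : (y i : SphericalJL.E (d + 1)) ≠ 0 := fun h => by simpa [h] using hy i
      have h1 : SphericalJL.toUnit (SphericalJL.scaledProj H (y i : SphericalJL.E (d + 1))) ≠ 0 :=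
        smul_ne_zero (inv_ne_zero (norm_ne_zero_iff.2 (hne i))) (hne i)
      dsimp only
      rw [SphericalJL.geodesicDist, SphericalJL.geodesicDist,
        InnerProductGeometry.angle_self h0, InnerProductGeometry.angle_self h1, mul_zero, mul_zero]
      exact ⟨le_rfl, le_rfl⟩
    · refine hangle (i, j) H hε hε' (hne i) (hne j) fun a => ?_
      by_contra ha
      exact hdist (Set.mem_iUnion₂.2 ⟨(i, j), by simpa using hij,
        Set.mem_iUnion.2 ⟨a, not_le.1 ha⟩⟩)
  calc _ ≤ _ := measure_mono hsub
    _ ≤ _ := measure_union_le _ _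
    _ ≤ 0 + ∑ z ∈ (Finset.univ : Finset (Fin n)).offDiag, ∑ _a : Fin 3,
          ENNReal.ofReal (2 * e) := by
        refine add_le_add (le_of_eq (measure_iUnion_null fun i =>
          SphericalJL.uniformGr_norm_proj_eq_zero _ hm (hy i))) ?_
        refine (measure_biUnion_finset_le _ _).trans (Finset.sum_le_sum fun z _ => ?_)
        exact (measure_iUnion_fintype_le _ _).trans (Finset.sum_le_sum fun a _ =>
          SphericalJL.uniformGr_distortion_le _ hm (hw z a) (by positivity) (by linarith))
    _ = ENNReal.ofReal (((n * n - n : ℕ) : ℝ) * (3 * (2 * e))) := by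
        rw [zero_add, Finset.sum_const, Finset.sum_const, Finset.offDiag_card, Finset.card_univ,
          Finset.card_univ, Fintype.card_fin, Fintype.card_fin, ENNReal.ofReal_mul (by positivity),
          ENNReal.ofReal_mul (by norm_num), ENNReal.ofReal_natCast, nsmul_eq_mul, nsmul_eq_mul]
        norm_num
    _ ≤ ENNReal.ofReal δ :=
        ENNReal.ofReal_le_ofReal (SphericalJL.six_mul_offDiag_mul_exp_le hε hδ hδ' hk)
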